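/- Let $n\ge 0$ and let $\mathcal P_n$ be the set of partitions $\lambda=(\lambda_1\ge\cdots\ge\lambda_n)\in\mathbb N^n$. Let $x_{(n)}=(x_1,\dots,x_n)$ and $y=(y_1,y_2,\dots)$ be variables. For $\lambda\in\mathcal P_n$ put $$s_\lambda(x_{(n)})=\sum_T\prod_{a\in T}x_a,\qquad s_\lambda(x_{(n)}\,|\,y)=\sum_T\prod_{a\in T}\bigl(x_a+y_{a+c(a)-r(a)}\bigr),$$ the sums being over all semistandard Young tableaux $T$ of shape $\lambda$ with entries in $\{1,\dots,n\}$, where $c(a)$ and $r(a)$ are the column and row numbers of the entry $a$. The families $(s_\mu(x_{(n)}))_{\mu\in\mathcal P_n}$ and $(s_\mu(x_{(n)}\,|\,y))_{\mu\in\mathcal P_n}$ are each linearly independent over $\mathbb Z[y]$, and there are unique finitely supported families of coefficients $c_{\lambda,n}^\mu(y),d_{\lambda,n}^\mu(y)\in\mathbb Z[y]$ with $$s_\lambda(x_{(n)}\,|\,y)=\sum_{\mu\in\mathcal P_n}c_{\lambda,n}^\mu(y)\,s_\mu(x_{(n)}),\qquad s_\lambda(x_{(n)})=\sum_{\mu\in\mathcal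 P_n}d_{\lambda,n}^\mu(y)\,s_\mu(x_{(n)}\,|\,y).$$ Let $e_r(z_{(p)})$ and $h_r(z_{(p)})$ be the elementary and complete symmetric polynomials of degree $r$ in $z_1,\dots,z_p$, which are $0$ for $r<0$, and let $-y=(-y_1,-y_2,\dots)$. For $\lambda\in\mathcal P_n$ and an integer $m\ge\lambda_1$ (any $m\ge 0$ if $n=0$), let $\lambda^c\in\mathcal P_m$ be the complementary partition, $\lambda^c_i=n-\lambda'_{m+1-i}$ for $1\le i\le m$, where $\lambda'_j=\#\{k:\lambda_k\ge j\}$. Then for all $\lambda,\mu\in\mathcal P_n$: (i) $c_{\lambda,n}^\mu(y)=\det\bigl(e_{\lambda_i-\mu_j-i+j}(y_{(\lambda_i+n-i)})\bigr)_{1\le i,j\le n}$; (ii) $d_{\lambda,n}^\mu(y)=\det\bigl(h_{\lambda_i-\mu_j-i+j}((-y)_{(\mu_j+n+1-j)})\bigr)_{1\le i,j\le n}$; (iii) $d_{\lambda,n}^\mu(y)=c_{\mu^c,m}^{\lambda^c}(-y)$ for every integer $m\ge 0$ with $m\ge\lambda_1$ and $m\ge\mu_1$, both complements being taken with respect to this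 $m$. -/

import Mathlib

open MvPolynomial

/-- `𝒫ₙ`: the partitions `(λ₁ ≥ ⋯ ≥ λₙ ≥ 0)`. The entry `lam.1 i` with `i = 0, …, n - 1` is
`λ_{i+1}`. -/
abbrev Parts (n : ℕ) : Type := {l : Fin n → ℕ // Antitone l}

/-- `ℤ[y]` with `y = (y₁, y₂, …)`; the variable `X k` is `y_{k+1}`. -/
abbrev ZY : Type := MvPolynomial ℕ ℤ

/-- `ℤ[x, y] = ℤ[y][x₁, …, xₙ]`; the variable `X i`, `i = 0, …, n - 1`, is `x_{i+1}`. -/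
abbrev ZXY (n : ℕ) : Type := MvPolynomial (Fin n) ZY

/-- The boxes of the Young diagram of `lam`: `⟨r, c⟩` is the box in row `r + 1`,
column `c + 1`. -/
abbrev Box {n : ℕ} (lam : Parts n) : Type := (r : Fin n) × Fin (lam.1 r)

/-- A filling of the diagram of `lam` is a Young (semistandard) tableau if its entries weakly
increase along rows and strictly increase down columns. -/
def IsTableau {n : ℕ} {lam : Parts n} (T : Box lam → Fin n) : Prop :=
  (∀ a b : Box lam, a.1 = b.1 → (a.2 : ℕ) ≤ b.2 → T a ≤ T b) ∧
    ∀ a b : Box lam, (a.2 : ℕ) = b.2 → a.1 < b.1 → T a < T b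

open Classical in
/-- All Young tableaux of shape `lam` with entries in `{1, …, n}`; an entry `a` is stored as
`a - 1 : Fin n`. -/
noncomputable def tableaux {n : ℕ} (lam : Parts n) : Finset (Box lam → Fin n) :=
  Finset.univ.filter IsTableau

/-- The Schur polynomial `s_λ(x_(n))`. -/
noncomputable def schurPoly {n : ℕ} (lam : Parts n) : ZXY n :=
  ∑ T ∈ tableaux lam, ∏ b : Box lam, X (T b)

/-- The factorial Schur polynomial `s_λ(x_(n) | y) = ∑_T ∏_a (x_a + y_{a + c(a) - r(a)})`.
Columns being strict, an entry is at least its row number, so the subtraction does not truncate;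
and `a + c - r` in indices from `1` is one more than `a + c - r` in indices from `0`. -/
noncomputable def factorialSchurPoly {n : ℕ} (lam : Parts n) : ZXY n :=
  ∑ T ∈ tableaux lam, ∏ b : Box lam,
    (X (T b) + C (X ((T b : ℕ) + (b.2 : ℕ) - (b.1 : ℕ))))

/-- The coefficients of an expansion `f = ∑ᵢ cᵢ bᵢ` (finitely many nonzero `cᵢ`). They are
determined when `b` is linearly independent and `f` lies in its span. -/
noncomputable def expansionCoeffs {ι R M : Type*} [CommRing R] [AddCommGroup M] [Module R M]
    (b : ι → M) (f : M) : ι →₀ R :=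
  Classical.epsilon fun c : ι →₀ R => f = Finsupp.linearCombination R b c

/-- `c_{λ,n}^μ(y)`, as a function of `μ`: the coefficients of `s_λ(x_(n) | y)` in the
Schur polynomials. -/
noncomputable def cCoeff {n : ℕ} (lam : Parts n) : Parts n →₀ ZY :=
  expansionCoeffs schurPoly (factorialSchurPoly lam)

/-- `d_{λ,n}^μ(y)`, as a function of `μ`: the coefficients of `s_λ(x_(n))` in the
factorial Schur polynomials. -/
noncomputable def dCoeff {n : ℕ} (lam : Parts n) : Parts n →₀ ZY :=
  expansionCoeffs factorialSchurPoly (schurPoly lam)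

/-- `e_r(z_(p)) = e_r(z₁, …, z_p)` for `r ∈ ℤ`, zero for `r < 0`; `z k` is `z_{k+1}`. -/
noncomputable def eInt {R : Type*} [CommRing R] (r : ℤ) (p : ℕ) (z : ℕ → R) : R :=
  if 0 ≤ r then aeval (fun i : Fin p => z i) (esymm (Fin p) ℤ r.toNat) else 0

/-- `h_r(z_(p)) = h_r(z₁, …, z_p)` for `r ∈ ℤ`, zero for `r < 0`; `z k` is `z_{k+1}`. -/
noncomputable def hInt {R : Type*} [CommRing R] (r : ℤ) (p : ℕ) (z : ℕ → R) : R :=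
  if 0 ≤ r then aeval (fun i : Fin p => z i) (hsymm (Fin p) ℤ r.toNat) else 0

/-- The substitution `f(y) ↦ f(-y)` on `ℤ[y]`. -/
noncomputable def negY : ZY →ₐ[ℤ] ZY := aeval fun k => -X k

/-- The conjugate partition: `conj lam j` is `λ'_{j+1}`, the length of column `j + 1`. -/
def conj {n : ℕ} (lam : Parts n) (j : ℕ) : ℕ :=
  (Finset.univ.filter fun i : Fin n => j < lam.1 i).card

/-- The complementary partition `λᶜ ∈ 𝒫ₘ`, `λᶜ_i = n - λ'_{m+1-i}` for `1 ≤ i ≤ m`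
(`Fin.rev` is `i ↦ m + 1 - i` in indices from `1`). -/
def complPart {n : ℕ} (m : ℕ) (lam : Parts n) : Parts m :=
  ⟨fun i => n - conj lam (Fin.rev i), fun i j hij => by
    refine Nat.sub_le_sub_left (Finset.card_le_card fun k hk => ?_) n
    simp only [Finset.mem_filter, Finset.mem_univ, true_and] at hk ⊢
    exact lt_of_le_of_lt (Fin.rev_le_rev.mpr hij) hk⟩

/-!
Sorting a tableau by the positions of its largest entry gives a branching rule, which by
induction on `n` yields the bialternant formula: `s_λ(x | y)` times the Vandermonde product is the
determinant of the factorial powers `(x_i + y_1) ⋯ (x_i + y_p)`, `p = λ_j + n - j`. Factorial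
powers for two parameter sequences are related by a lower unitriangular matrix, whose entries are
elementary or complete symmetric polynomials when one of the sequences vanishes, so by Cauchy–Binet
the change of basis coefficients are minors of that matrix. Exchanging the two sequences inverts
the matrix, and the rows missing from the minor of `λ` are those of `λᶜ`; duality is Jacobi's
theorem on complementary minors.
-/

section Determinants

variable {R : Type*} [CommRing R]

theorem det_of_sum_rows {ι κ : Type*} [Fintype ι] [DecidableEq ι] (s : ι → Finset κ)
    (v : ι → κ → ι → R) :
    (Matrix.of fun i j => ∑ k ∈ s i, v i k j).det =
      ∑ p ∈ Fintype.piFinset s, (Matrix.of fun i j => v i (p i) j).det := by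
  have hrows : (Matrix.of fun i j => ∑ k ∈ s i, v i k j) = fun i => ∑ k ∈ s i, v i k := by
    ext i j
    simp
  rw [hrows]
  exact (Matrix.detRowAlternating (R := R) (n := ι)).toMultilinearMap.map_sum_finset v s

theorem det_eq_of_row_recurrence {n : ℕ} {A : Matrix (Fin (n + 1)) (Fin (n + 1)) R}
    {B : Matrix (Fin n) (Fin (n + 1)) R} (c : Fin n → R)
    (hA : ∀ i j, A i.castSucc j = B i j + c i * A i.succ j) (hB : ∀ i, B i (Fin.last n) = 0) :
    A.det = A (Fin.last n) (Fin.last n) * (B.submatrix id Fin.castSucc).det := by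
  let D : Matrix (Fin (n + 1)) (Fin (n + 1)) R :=
    Matrix.of (Fin.snoc (α := fun _ => Fin (n + 1) → R) B (A (Fin.last n)))
  have hDcast (i : Fin n) (j) : D i.castSucc j = B i j :=
    congrFun (Fin.snoc_castSucc (α := fun _ => Fin (n + 1) → R) (A (Fin.last n)) B i) j
  have hDlast (j) : D (Fin.last n) j = A (Fin.last n) j :=
    congrFun (Fin.snoc_last (α := fun _ => Fin (n + 1) → R) (A (Fin.last n)) B) j
  have hAD : A.det = D.det := by
    rw [← Matrix.det_submatrix_equiv_self Fin.revPerm A,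
      ← Matrix.det_submatrix_equiv_self Fin.revPerm D]
    refine Matrix.det_eq_of_forall_row_eq_smul_add_pred (fun i => c i.rev) (fun j => ?_)
      (fun i j => ?_)
    · simp [hDlast]
    · simp [hDcast, hA, Fin.rev_succ, Fin.rev_castSucc]
  have hDB : D.submatrix Fin.castSucc Fin.castSucc = B.submatrix id Fin.castSucc := by
    ext i j
    simp [hDcast]
  rw [hAD, Matrix.det_succ_column D (Fin.last n), Fin.sum_univ_castSucc]
  simp [hDcast, hDlast, hB, ← two_mul, Fin.succAbove_last, hDB]

theorem perm_eq_one_of_strictAnti_comp {ι κ : Type*} [LinearOrder ι] [Finite ι] [LinearOrder κ]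
    {f : ι → κ} (hf : StrictAnti f) {σ : Equiv.Perm ι} (h : StrictAnti (f ∘ σ)) : σ = 1 := by
  have hσ : StrictMono σ := fun i j hij => hf.lt_iff_gt.mp (h hij)
  have := Finite.to_wellFoundedLT (α := ι)
  exact Equiv.ext fun i => congrArg (fun e : ι ≃o ι => e i)
    (Subsingleton.elim (hσ.orderIsoOfSurjective σ σ.surjective) (OrderIso.refl ι))

theorem sum_piFinset_eq_sum_strictAnti {n : ℕ} {κ M : Type*} [LinearOrder κ] [AddCommMonoid M]
    (s : Finset κ) (F : (Fin n → κ) → M) (hF : ∀ p, ¬ Function.Injective p → F p = 0) :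
    ∑ p ∈ Fintype.piFinset fun _ => s, F p =
      ∑ p ∈ Fintype.piFinset fun _ => s with StrictAnti p,
        ∑ σ : Equiv.Perm (Fin n), F (p ∘ σ) := by
  rw [← Finset.sum_product']
  symm
  refine Finset.sum_of_injOn (fun q => q.1 ∘ q.2) ?_ ?_ ?_ (fun _ _ => rfl)
  · rintro ⟨p, σ⟩ hp ⟨q, τ⟩ hq (h : p ∘ σ = q ∘ τ)
    simp only [Finset.coe_product, Set.mem_prod, Finset.mem_coe, Finset.mem_filter] at hp hq
    have hpq : p ∘ (σ * τ⁻¹ : Equiv.Perm (Fin n)) = q := by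
      funext i
      simpa using congrFun h (τ⁻¹ i)
    have hστ := perm_eq_one_of_strictAnti_comp hp.1.2 (hpq ▸ hq.1.2)
    rw [hστ] at hpq
    exact Prod.ext hpq (mul_inv_eq_one.mp hστ)
  · rintro ⟨p, σ⟩ hp
    simp only [Finset.coe_product, Set.mem_prod, Finset.mem_coe, Finset.mem_filter,
      Fintype.mem_piFinset] at hp ⊢
    exact fun i => hp.1.1 (σ i)
  · intro p hp hp'
    refine hF p fun hinj => hp' ?_
    let σ := Tuple.sort (OrderDual.toDual ∘ p)
    have hanti : Antitone (p ∘ σ) := Tuple.monotone_sort (OrderDual.toDual ∘ p)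
    refine ⟨(p ∘ σ, σ⁻¹), ?_, by ext i; simp⟩
    simp only [Finset.coe_product, Set.mem_prod, Finset.mem_coe, Finset.mem_filter,
      Fintype.mem_piFinset, Finset.mem_univ, and_true] at hp ⊢
    exact ⟨fun i => hp (σ i), hanti.strictAnti_of_injective (hinj.comp σ.injective)⟩

theorem cauchyBinet {n : ℕ} {α κ : Type*} [LinearOrder κ] (s : Finset κ)
    (A : Matrix (Fin n) κ R) (B : Matrix κ α R) (g : Fin n → α) :
    (Matrix.of fun i j => ∑ k ∈ s, A i k * B k (g j)).det =
      ∑ p ∈ Fintype.piFinset fun _ => s with StrictAnti p,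
        (A.submatrix id p).det * (B.submatrix p g).det := by
  rw [det_of_sum_rows (fun _ => s) (fun i k j => A i k * B k (g j)),
    sum_piFinset_eq_sum_strictAnti]
  · refine Finset.sum_congr rfl fun p _ => ?_
    rw [← Matrix.det_transpose (A.submatrix id p), Matrix.det_apply', Finset.sum_mul]
    refine Finset.sum_congr rfl fun σ _ => ?_
    have hσ := Matrix.det_mul_column (fun i => A i (p (σ i))) (B.submatrix (p ∘ σ) g)
    have hperm := Matrix.det_permute σ (B.submatrix p g)
    simp only [Matrix.submatrix_submatrix, Matrix.submatrix_apply, Function.comp_id,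
      Function.comp_apply, Matrix.transpose_apply, id_eq] at hσ hperm ⊢
    rw [hσ, hperm]
    ring
  · intro p hp
    obtain ⟨i, j, hij, hne⟩ : ∃ i j, p i = p j ∧ i ≠ j := by
      simpa [Function.Injective] using hp
    have hcol := Matrix.det_mul_column (fun i => A i (p i)) (B.submatrix p g)
    simp only [Matrix.submatrix_apply] at hcol
    rw [hcol, Matrix.det_zero_of_row_eq hne (by funext k; simp [hij]), mul_zero]

theorem det_one_submatrix_of_strictAnti {n : ℕ} {κ : Type*} [LinearOrder κ] {f g : Fin n → κ}
    (hf : StrictAnti f) (hg : StrictAnti g) :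
    ((1 : Matrix κ κ R).submatrix f g).det = if f = g then 1 else 0 := by
  rw [Matrix.det_apply', Finset.sum_eq_single 1]
  · split_ifs with h
    · simp [h]
    · obtain ⟨i, hi⟩ := Function.ne_iff.mp h
      rw [Finset.prod_eq_zero (Finset.mem_univ i) (by simp [hi]), mul_zero]
  · intro σ _ hσ
    obtain ⟨i, hi⟩ : ∃ i, f (σ i) ≠ g i := by
      by_contra! h
      exact hσ (perm_eq_one_of_strictAnti_comp hf (by rwa [show f ∘ σ = g from funext h]))
    rw [Finset.prod_eq_zero (Finset.mem_univ i) (by simp [hi]), mul_zero]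
  · simp

theorem det_mul_det_toBlocks₁₁_of_mul_eq_one {ι κ : Type*} [Fintype ι] [Fintype κ]
    [DecidableEq ι] [DecidableEq κ] {M M' : Matrix (ι ⊕ κ) (ι ⊕ κ) R} (h : M * M' = 1) :
    M.det * M'.toBlocks₁₁.det = M.toBlocks₂₂.det := by
  rw [← Matrix.fromBlocks_toBlocks M, ← Matrix.fromBlocks_toBlocks M',
    Matrix.fromBlocks_multiply, ← Matrix.fromBlocks_one, Matrix.fromBlocks_inj] at h
  have key : M * Matrix.fromBlocks M'.toBlocks₁₁ 0 M'.toBlocks₂₁ 1 =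
      Matrix.fromBlocks 1 M.toBlocks₁₂ 0 M.toBlocks₂₂ := by
    conv_lhs => rw [← Matrix.fromBlocks_toBlocks M]
    rw [Matrix.fromBlocks_multiply, h.1, h.2.2.1]
    simp
  have := congrArg Matrix.det key
  rwa [Matrix.det_mul, Matrix.det_fromBlocks_zero₁₂, Matrix.det_fromBlocks_zero₂₁,
    Matrix.det_one, Matrix.det_one, mul_one, one_mul] at this

theorem jacobi_complementary_minor {ι κ ν : Type*} [Fintype ι] [Fintype κ] [Fintype ν]
    [DecidableEq ι] [DecidableEq κ] [DecidableEq ν] {M M' : Matrix ν ν R} (h : M * M' = 1)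
    (e f : ι ⊕ κ ≃ ν) :
    M.det * Equiv.Perm.sign (e.symm.trans f) *
        (M'.submatrix (f ∘ Sum.inl) (e ∘ Sum.inl)).det =
      (M.submatrix (e ∘ Sum.inr) (f ∘ Sum.inr)).det := by
  have hdet : (M.submatrix e f).det = M.det * Equiv.Perm.sign (e.symm.trans f) := by
    rw [mul_comm, ← Matrix.det_permute', ← Matrix.det_submatrix_equiv_self e]
    simp [Matrix.submatrix_submatrix, Function.comp_def]
  rw [← hdet]
  exact det_mul_det_toBlocks₁₁_of_mul_eq_one (M := M.submatrix e f) (M' := M'.submatrix f e)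
    (by rw [Matrix.submatrix_mul_equiv, h, Matrix.submatrix_one_equiv])

end Determinants

section FactorialPowers

variable {R : Type*} [CommRing R]

/-- The factorial power `(t | y)^p = (t + y₁) ⋯ (t + y_p)`. -/
def factorialPow (y : ℕ → R) (t : R) (p : ℕ) : R :=
  ∏ k ∈ Finset.range p, (t + y k)

theorem factorialPow_succ (y : ℕ → R) (t : R) (p : ℕ) :
    factorialPow y t (p + 1) = (t + y p) * factorialPow y t p := by
  rw [factorialPow, Finset.prod_range_succ, mul_comm, factorialPow]

theorem factorialPow_add (y : ℕ → R) (t : R) (p d : ℕ) :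
    factorialPow y t (p + d) = factorialPow (fun k => y (d + k)) t p * factorialPow y t d := by
  rw [add_comm, factorialPow, Finset.prod_range_add, mul_comm]
  rfl

theorem factorialPow_zero_left (t : R) (p : ℕ) : factorialPow 0 t p = t ^ p := by
  simp [factorialPow]

theorem factorialPow_telescope (y : ℕ → R) (t z : R) {a b : ℕ} (hab : a ≤ b) :
    factorialPow y t (b + 1) =
      (t - z) * ∑ k ∈ Finset.Icc a b,
        (∏ c ∈ Finset.Ico k b, (z + y (c + 1))) * factorialPow y t k +
      (∏ c ∈ Finset.Ico a (b + 1), (z + y c)) * factorialPow y t a := by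
  induction b, hab using Nat.le_induction with
  | base =>
    simp only [factorialPow_succ, Finset.Icc_self, Finset.sum_singleton, Finset.Ico_self,
      Finset.prod_empty, Nat.Ico_succ_singleton, Finset.prod_singleton]
    ring
  | succ b hab ih =>
    have hsum : ∑ k ∈ Finset.Icc a (b + 1),
        (∏ c ∈ Finset.Ico k (b + 1), (z + y (c + 1))) * factorialPow y t k =
        (z + y (b + 1)) * ∑ k ∈ Finset.Icc a b,
          (∏ c ∈ Finset.Ico k b, (z + y (c + 1))) * factorialPow y t k +
        factorialPow y t (b + 1) := by
      rw [Finset.sum_Icc_succ_top (hab.trans b.le_succ), Finset.mul_sum, Finset.Ico_self,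
        Finset.prod_empty, one_mul]
      congr 1
      refine Finset.sum_congr rfl fun k hk => ?_
      rw [Finset.prod_Ico_succ_top (Finset.mem_Icc.mp hk).2]
      ring
    rw [factorialPow_succ, hsum, Finset.prod_Ico_succ_top (hab.trans b.le_succ)]
    linear_combination (z + y (b + 1)) * ih

/-- The change of basis `(t | y)^p = ∑_q T(y, z)_{p,q} (t | z)^q` between factorial powers with
different parameters. The recursion is that of `(t + y_{p+1}) (t | y)^p`, where `t` is split as
`(t + z_{q+1}) - z_{q+1}`. -/
def transitionMatrix (y z : ℕ → R) : Matrix ℕ ℕ R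
  | 0, 0 => 1
  | 0, _ + 1 => 0
  | p + 1, 0 => (y p - z 0) * transitionMatrix y z p 0
  | p + 1, q + 1 => transitionMatrix y z p q + (y p - z (q + 1)) * transitionMatrix y z p (q + 1)

theorem transitionMatrix_succ_zero (y z : ℕ → R) (p : ℕ) :
    transitionMatrix y z (p + 1) 0 = (y p - z 0) * transitionMatrix y z p 0 := rfl

theorem transitionMatrix_succ_succ (y z : ℕ → R) (p q : ℕ) :
    transitionMatrix y z (p + 1) (q + 1) =
      transitionMatrix y z p q + (y p - z (q + 1)) * transitionMatrix y z p (q + 1) := rfl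

theorem transitionMatrix_of_lt (y z : ℕ → R) {p q : ℕ} (h : p < q) :
    transitionMatrix y z p q = 0 := by
  induction p generalizing q with
  | zero => obtain _ | q := q; exacts [absurd h (lt_irrefl _), rfl]
  | succ p ih =>
    obtain _ | q := q
    · exact absurd h (Nat.not_lt_zero _)
    · rw [transitionMatrix_succ_succ, ih (Nat.lt_of_succ_lt_succ h), ih (Nat.lt_of_succ_lt h),
        mul_zero, add_zero]

theorem transitionMatrix_apply_self (y z : ℕ → R) (p : ℕ) : transitionMatrix y z p p = 1 := by
  induction p with
  | zero => rfl
  | succ p ih =>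
    rw [transitionMatrix_succ_succ, ih, transitionMatrix_of_lt y z p.lt_succ_self, mul_zero,
      add_zero]

theorem transitionMatrix_self (y : ℕ → R) : transitionMatrix y y = 1 := by
  ext p q
  induction p generalizing q with
  | zero => obtain _ | q := q <;> rfl
  | succ p ih =>
    obtain _ | q := q
    · obtain _ | p := p <;> simp [transitionMatrix_succ_zero, ih]
    · rw [transitionMatrix_succ_succ, ih, ih]
      obtain rfl | hpq := eq_or_ne p (q + 1)
      · simp
      · simp [hpq, Matrix.one_apply]

theorem transitionMatrix_neg (y z : ℕ → R) (p q : ℕ) :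
    transitionMatrix (-y) (-z) p q = (-1) ^ (p + q) * transitionMatrix y z p q := by
  induction p generalizing q with
  | zero => obtain _ | q := q <;> simp [transitionMatrix]
  | succ p ih =>
    obtain _ | q := q
    · simp only [transitionMatrix_succ_zero, ih, Pi.neg_apply]
      ring
    · simp only [transitionMatrix_succ_succ, ih, Pi.neg_apply]
      ring

theorem map_transitionMatrix {S : Type*} [CommRing S] (φ : R →+* S) (y z : ℕ → R) (p q : ℕ) :
    φ (transitionMatrix y z p q) = transitionMatrix (φ ∘ y) (φ ∘ z) p q := by
  induction p generalizing q with
  | zero => obtain _ | q := q <;> simp [transitionMatrix]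
  | succ p ih => obtain _ | q := q <;> simp [transitionMatrix, ih]

theorem sum_transitionMatrix_succ_mul (y z : ℕ → R) (f : ℕ → R) {p N : ℕ} (h : p < N) :
    ∑ q ∈ Finset.range (N + 1), transitionMatrix y z (p + 1) q * f q =
      ∑ q ∈ Finset.range N, transitionMatrix y z p q * (f (q + 1) + (y p - z q) * f q) := by
  have hlast : ∑ q ∈ Finset.range N, (y p - z q) * transitionMatrix y z p q * f q =
      ∑ q ∈ Finset.range (N + 1), (y p - z q) * transitionMatrix y z p q * f q := by
    rw [Finset.sum_range_succ, transitionMatrix_of_lt y z h, mul_zero, zero_mul, add_zero]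
  calc _ = ∑ q ∈ Finset.range N, transitionMatrix y z p q * f (q + 1) +
        ∑ q ∈ Finset.range (N + 1), (y p - z q) * transitionMatrix y z p q * f q := by
        simp only [Finset.sum_range_succ' _ N, transitionMatrix_succ_succ,
          transitionMatrix_succ_zero, add_mul, Finset.sum_add_distrib, add_assoc]
    _ = _ := by
        rw [← hlast, ← Finset.sum_add_distrib]
        exact Finset.sum_congr rfl fun q _ => by ring

theorem factorialPow_eq_sum_transitionMatrix (y z : ℕ → R) (t : R) {p N : ℕ} (h : p < N) :
    factorialPow y t p = ∑ q ∈ Finset.range N, transitionMatrix y z p q * factorialPow z t q := by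
  induction p generalizing N with
  | zero =>
    obtain ⟨N, rfl⟩ := Nat.exists_eq_add_of_lt h
    simp [Finset.sum_range_succ', transitionMatrix, factorialPow]
  | succ p ih =>
    obtain _ | N := N
    · exact absurd h (Nat.not_lt_zero _)
    · have hp := Nat.lt_of_succ_lt_succ h
      rw [sum_transitionMatrix_succ_mul y z _ hp, factorialPow_succ, ih hp, Finset.mul_sum]
      exact Finset.sum_congr rfl fun q _ => by rw [factorialPow_succ]; ring

theorem sum_transitionMatrix_mul_transitionMatrix (y z w : ℕ → R) {p N : ℕ} (h : p < N) (r : ℕ) :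
    ∑ q ∈ Finset.range N, transitionMatrix y z p q * transitionMatrix z w q r =
      transitionMatrix y w p r := by
  induction p generalizing N r with
  | zero =>
    obtain ⟨N, rfl⟩ := Nat.exists_eq_add_of_lt h
    obtain _ | r := r <;> simp [Finset.sum_range_succ', transitionMatrix]
  | succ p ih =>
    obtain _ | N := N
    · exact absurd h (Nat.not_lt_zero _)
    · have hp := Nat.lt_of_succ_lt_succ h
      rw [sum_transitionMatrix_succ_mul y z _ hp]
      obtain _ | r := r
      · rw [transitionMatrix_succ_zero, ← ih hp, Finset.mul_sum]
        exact Finset.sum_congr rfl fun q _ => by rw [transitionMatrix_succ_zero]; ring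
      · rw [transitionMatrix_succ_succ, ← ih hp, ← ih hp, Finset.mul_sum,
          ← Finset.sum_add_distrib]
        exact Finset.sum_congr rfl fun q _ => by rw [transitionMatrix_succ_succ]; ring

end FactorialPowers

section SymmetricPolynomials

variable {R : Type*} [CommRing R]

theorem eInt_of_neg {r : ℤ} (hr : r < 0) (p : ℕ) (z : ℕ → R) : eInt r p z = 0 :=
  if_neg hr.not_ge

theorem hInt_of_neg {r : ℤ} (hr : r < 0) (p : ℕ) (z : ℕ → R) : hInt r p z = 0 :=
  if_neg hr.not_ge

theorem coeff_prod_X_add_C_range (y : ℕ → R) (p q : ℕ) :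
    (∏ k ∈ Finset.range p, (Polynomial.X + Polynomial.C (y k))).coeff q =
      transitionMatrix y 0 p q := by
  induction p generalizing q with
  | zero => obtain _ | q := q <;> simp [transitionMatrix, Polynomial.coeff_one]
  | succ p ih =>
    rw [Finset.prod_range_succ, mul_add, Polynomial.coeff_add, Polynomial.coeff_mul_C, ih]
    obtain _ | q := q
    · rw [Polynomial.coeff_mul_X_zero, transitionMatrix_succ_zero, Pi.zero_apply]
      ring
    · rw [Polynomial.coeff_mul_X, ih, transitionMatrix_succ_succ, Pi.zero_apply]
      ring

theorem transitionMatrix_zero_right (y : ℕ → R) (p q : ℕ) :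
    transitionMatrix y 0 p q = eInt ((p : ℤ) - q) p y := by
  rcases le_or_gt q p with h | h
  · rw [← coeff_prod_X_add_C_range,
      ← Fin.prod_univ_eq_prod_range (fun k => Polynomial.X + Polynomial.C (y k)) p,
      Finset.prod_X_add_C_coeff _ _ (by simpa using h), eInt, if_pos (by lia),
      aeval_esymm_eq_multiset_esymm, Finset.esymm_map_val]
    congr 2
    simp
  · rw [transitionMatrix_of_lt y 0 h, eInt_of_neg (by lia)]

theorem aeval_hsymm_eq_sum {σ : Type*} [Fintype σ] [DecidableEq σ] (k : ℕ) (f : σ → R) :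
    aeval f (hsymm σ ℤ k) = ∑ s : Sym σ k, (s.1.map f).prod := by
  simp [hsymm, map_sum, map_multiset_prod, Multiset.map_map]

theorem aeval_hsymm_option_succ {σ : Type*} [Fintype σ] [DecidableEq σ] (k : ℕ)
    (f : Option σ → R) :
    aeval f (hsymm (Option σ) ℤ (k + 1)) =
      f none * aeval f (hsymm (Option σ) ℤ k) + aeval (f ∘ some) (hsymm σ ℤ (k + 1)) := by
  rw [aeval_hsymm_eq_sum, aeval_hsymm_eq_sum, aeval_hsymm_eq_sum,
    ← symOptionSuccEquiv.symm.sum_comp, Fintype.sum_sum_type, Finset.mul_sum]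
  congr 1
  · refine Finset.sum_congr rfl fun s _ => ?_
    change (Multiset.map f (none ::ₘ s.1)).prod = _
    simp
  · refine Finset.sum_congr rfl fun s _ => ?_
    change (Multiset.map f (Multiset.map some s.1)).prod = _
    rw [Multiset.map_map]

theorem hInt_natCast_succ (k p : ℕ) (z : ℕ → R) :
    hInt (k + 1 : ℕ) (p + 1) z =
      hInt (k + 1 : ℕ) p z + z p * hInt k (p + 1) z := by
  have hrename (r : ℕ) : aeval (fun i : Fin (p + 1) => z i) (hsymm (Fin (p + 1)) ℤ r) =
      aeval (fun i => z (finSuccEquivLast.symm i)) (hsymm (Option (Fin p)) ℤ r) := by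
    rw [← rename_hsymm (Option (Fin p)) ℤ r finSuccEquivLast.symm, aeval_rename]
    rfl
  simp only [hInt, Int.natCast_nonneg, if_true, Int.toNat_natCast, hrename,
    aeval_hsymm_option_succ]
  simp [Function.comp_def, add_comm]

theorem transitionMatrix_zero_left (y : ℕ → R) (p q : ℕ) :
    transitionMatrix 0 y p q = hInt ((p : ℤ) - q) (q + 1) (-y) := by
  induction p generalizing q with
  | zero =>
    obtain _ | q := q
    · simp [transitionMatrix, hInt]
    · rw [transitionMatrix_of_lt _ _ q.succ_pos, hInt_of_neg (by lia)]
  | succ p ih =>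
    obtain h | rfl | h := lt_trichotomy (p + 1) q
    · rw [transitionMatrix_of_lt _ _ h, hInt_of_neg (by lia)]
    · simp [transitionMatrix_apply_self, hInt]
    · obtain ⟨k, rfl⟩ : ∃ k, p = q + k := ⟨p - q, by lia⟩
      rw [show ((q + k + 1 : ℕ) : ℤ) - q = (k + 1 : ℕ) by lia, hInt_natCast_succ]
      obtain _ | q := q
      · have h0 : hInt (k + 1 : ℕ) 0 (-y) = 0 := by simp [hInt, hsymm]
        rw [transitionMatrix_succ_zero, ih, h0, show ((0 + k : ℕ) : ℤ) - (0 : ℕ) = k by lia]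
        simp
      · rw [transitionMatrix_succ_succ, ih, ih,
          show ((q + 1 + k : ℕ) : ℤ) - q = (k + 1 : ℕ) by lia,
          show ((q + 1 + k : ℕ) : ℤ) - (q + 1 : ℕ) = k by lia]
        simp

end SymmetricPolynomials

section ShiftedParts

variable {n : ℕ}

/-- The exponents `λ_i + n - i` (in indices from `1`), strictly decreasing in `i`. -/
def shiftedPart (lam : Parts n) (i : Fin n) : ℕ := lam.1 i + (Fin.rev i : ℕ)

theorem strictAnti_shiftedPart (lam : Parts n) : StrictAnti (shiftedPart lam) := fun _ _ hij =>
  Nat.add_lt_add_of_le_of_lt (lam.2 hij.le) (Fin.rev_lt_rev.mpr hij)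

theorem shiftedPart_injective : Function.Injective (shiftedPart (n := n)) := fun _ _ h =>
  Subtype.ext (funext fun i => Nat.add_right_cancel (congrFun h i))

theorem antitone_add_val_of_strictAnti {f : Fin n → ℕ} (hf : StrictAnti f) :
    Antitone fun i => f i + i := by
  refine (antitone_iff_forall_covBy _).mpr fun i j hij => ?_
  have hlt := hf hij.lt
  have hval : (i : ℕ) + 1 = j := Nat.covBy_iff_add_one_eq.mp (Fin.covBy_iff.mp hij)
  lia

theorem exists_shiftedPart_eq {f : Fin n → ℕ} (hf : StrictAnti f) :
    ∃ lam, shiftedPart lam = f := by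
  have hanti := antitone_add_val_of_strictAnti hf
  have hrev (i : Fin n) : (Fin.rev i : ℕ) ≤ f i := by
    have hi := i.isLt
    have := hanti (Fin.le_def.mpr (Nat.le_sub_one_of_lt hi) : i ≤ ⟨n - 1, by lia⟩)
    simp only [Fin.val_rev] at this ⊢
    lia
  refine ⟨⟨fun i => f i - Fin.rev i, fun i j hij => ?_⟩,
    funext fun i => Nat.sub_add_cancel (hrev i)⟩
  have := hanti hij
  simp only [Fin.val_rev] at this ⊢
  lia

/-- The finitely many partitions whose shifted parts are all less than `N`. -/
def partsBelow (n N : ℕ) : Finset (Parts n) :=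
  (Fintype.piFinset fun i : Fin n => Finset.range (N - Fin.rev i)).subtype Antitone

theorem mem_partsBelow {N : ℕ} {lam : Parts n} :
    lam ∈ partsBelow n N ↔ ∀ i, shiftedPart lam i < N := by
  simp only [partsBelow, Finset.mem_subtype, Fintype.mem_piFinset, Finset.mem_range, shiftedPart,
    Nat.lt_sub_iff_add_lt]

theorem sum_strictAnti_eq_sum_partsBelow {M : Type*} [AddCommMonoid M] (N : ℕ)
    (F : (Fin n → ℕ) → M) :
    ∑ p ∈ Fintype.piFinset fun _ => Finset.range N with StrictAnti p, F p =
      ∑ lam ∈ partsBelow n N, F (shiftedPart lam) := by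
  symm
  refine Finset.sum_nbij shiftedPart (fun lam hlam => ?_) shiftedPart_injective.injOn
    (fun p hp => ?_) fun _ _ => rfl
  · simpa [strictAnti_shiftedPart] using mem_partsBelow.mp hlam
  · rw [Finset.mem_coe, Finset.mem_filter, Fintype.mem_piFinset] at hp
    obtain ⟨lam, rfl⟩ := exists_shiftedPart_eq hp.2
    exact ⟨lam, mem_partsBelow.mpr fun i => Finset.mem_range.mp (hp.1 i), rfl⟩

theorem mem_partsBelow_sup (lam : Parts n) :
    lam ∈ partsBelow n (Finset.univ.sup (shiftedPart lam) + 1) :=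
  mem_partsBelow.mpr fun i => Nat.lt_succ_of_le (Finset.le_sup (Finset.mem_univ i))

end ShiftedParts

section TransitionMinors

variable {n : ℕ} {R : Type*} [CommRing R]

theorem det_transitionMatrix_submatrix_eq_zero (y z : ℕ → R) {f g : Fin n → ℕ} {j : Fin n}
    (h : ∀ i, f i < g j) : ((transitionMatrix y z).submatrix f g).det = 0 :=
  Matrix.det_eq_zero_of_column_eq_zero j fun i => transitionMatrix_of_lt y z (h i)

/-- The minors of the transition matrix in the rows `λ_i + n - i`, as a function of the partition
`μ` giving the columns `μ_j + n - j`. They expand the alternants, hence the factorial Schur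
polynomials, with parameters `y` in those with parameters `z`. -/
noncomputable def transitionMinor (y z : ℕ → R) (lam : Parts n) : Parts n →₀ R :=
  Finsupp.onFinset (partsBelow n (Finset.univ.sup (shiftedPart lam) + 1))
    (fun mu => ((transitionMatrix y z).submatrix (shiftedPart lam) (shiftedPart mu)).det)
    fun mu hmu => mem_partsBelow.mpr fun j => by
      contrapose! hmu
      exact det_transitionMatrix_submatrix_eq_zero y z fun i =>
        (mem_partsBelow.mp (mem_partsBelow_sup lam) i).trans_le hmu

theorem transitionMinor_apply (y z : ℕ → R) (lam mu : Parts n) :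
    transitionMinor y z lam mu =
      ((transitionMatrix y z).submatrix (shiftedPart lam) (shiftedPart mu)).det := rfl

theorem linearCombination_transitionMinor {M : Type*} [AddCommGroup M] [Module R M]
    (y z : ℕ → R) (b : Parts n → M) (lam : Parts n) :
    Finsupp.linearCombination R b (transitionMinor y z lam) =
      ∑ mu ∈ partsBelow n (Finset.univ.sup (shiftedPart lam) + 1),
        transitionMinor y z lam mu • b mu :=
  Finsupp.linearCombination_onFinset ..

theorem linearCombination_transitionMinor_comp (y z w : ℕ → R) (lam : Parts n) :
    Finsupp.linearCombination R (transitionMinor z w) (transitionMinor y z lam) =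
      transitionMinor y w lam := by
  ext nu
  have hcomp : (transitionMatrix y w).submatrix (shiftedPart lam) (shiftedPart nu) =
      Matrix.of fun i j => ∑ k ∈ Finset.range (Finset.univ.sup (shiftedPart lam) + 1),
        (transitionMatrix y z).submatrix (shiftedPart lam) id i k *
          transitionMatrix z w k (shiftedPart nu j) := by
    ext i j
    exact (sum_transitionMatrix_mul_transitionMatrix y z w
      (mem_partsBelow.mp (mem_partsBelow_sup lam) i) _).symm
  rw [linearCombination_transitionMinor, transitionMinor_apply, hcomp, cauchyBinet,
    sum_strictAnti_eq_sum_partsBelow, Finsupp.finsetSum_apply]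
  rfl

theorem transitionMinor_self (y : ℕ → R) (lam : Parts n) :
    transitionMinor y y lam = Finsupp.single lam 1 := by
  ext mu
  rw [transitionMinor_apply, transitionMatrix_self, Finsupp.single_apply,
    det_one_submatrix_of_strictAnti (strictAnti_shiftedPart lam) (strictAnti_shiftedPart mu)]
  simp only [shiftedPart_injective.eq_iff]

theorem map_transitionMinor {S : Type*} [CommRing S] (φ : R →+* S) (y z : ℕ → R)
    (lam mu : Parts n) :
    φ (transitionMinor y z lam mu) = transitionMinor (φ ∘ y) (φ ∘ z) lam mu := by
  rw [transitionMinor_apply, transitionMinor_apply, RingHom.map_det]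
  congr 1
  ext i j
  exact map_transitionMatrix φ y z _ _

theorem transitionMinor_zero_right (y : ℕ → R) (lam mu : Parts n) :
    transitionMinor y 0 lam mu =
      (Matrix.of fun i j : Fin n =>
        eInt ((lam.1 i : ℤ) - mu.1 j - i + j) (lam.1 i + n - (i + 1)) y).det := by
  rw [transitionMinor_apply]
  congr 1
  ext i j
  rw [Matrix.submatrix_apply, transitionMatrix_zero_right, Matrix.of_apply]
  have hi := i.isLt
  have hj := j.isLt
  congr 1 <;> simp only [shiftedPart, Fin.val_rev] <;> lia

theorem transitionMinor_zero_left (y : ℕ → R) (lam mu : Parts n) :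
    transitionMinor 0 y lam mu =
      (Matrix.of fun i j : Fin n =>
        hInt ((lam.1 i : ℤ) - mu.1 j - i + j) (mu.1 j + n + 1 - (j + 1)) (-y)).det := by
  rw [transitionMinor_apply]
  congr 1
  ext i j
  rw [Matrix.submatrix_apply, transitionMatrix_zero_left, Matrix.of_apply]
  have hi := i.isLt
  have hj := j.isLt
  congr 1 <;> simp only [shiftedPart, Fin.val_rev] <;> lia

end TransitionMinors

section Alternants

variable {n : ℕ} {R : Type*} [CommRing R]

/-- The Vandermonde product `∏_{i < j} (x_i - x_j)`. -/
def vandermondeProd (x : Fin n → R) : R :=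
  ∏ j, ∏ i ∈ Finset.Iio j, (x i - x j)

theorem vandermondeProd_succ (x : Fin (n + 1) → R) :
    vandermondeProd x = vandermondeProd (x ∘ Fin.castSucc) *
      ∏ j : Fin n, (x j.castSucc - x (Fin.last n)) := by
  simp only [vandermondeProd, Fin.prod_univ_castSucc, Fin.prod_Iio_castSucc, Fin.Iio_last_eq_map,
    Finset.prod_map]
  rfl

/-- The alternant `det ((x_j | y)^{λ_i + n - i})`, the numerator of the bialternant formula. -/
def alternant (y : ℕ → R) (x : Fin n → R) (lam : Parts n) : R :=
  (Matrix.of fun i j => factorialPow y (x j) (shiftedPart lam i)).det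

theorem alternant_eq_linearCombination (y z : ℕ → R) (x : Fin n → R) (lam : Parts n) :
    alternant y x lam =
      Finsupp.linearCombination R (alternant z x) (transitionMinor y z lam) := by
  have hexp : (Matrix.of fun i j => factorialPow y (x j) (shiftedPart lam i)) =
      Matrix.of fun i j => ∑ k ∈ Finset.range (Finset.univ.sup (shiftedPart lam) + 1),
        (transitionMatrix y z).submatrix (shiftedPart lam) id i k *
          Matrix.of (fun k j => factorialPow z (x j) k) k (id j) := by
    ext i j
    exact factorialPow_eq_sum_transitionMatrix y z (x j)
      (mem_partsBelow.mp (mem_partsBelow_sup lam) i)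
  rw [alternant, hexp, cauchyBinet, sum_strictAnti_eq_sum_partsBelow,
    linearCombination_transitionMinor]
  rfl

/-- The shapes `μ` with `λ₁ ≥ μ₁ ≥ λ₂ ≥ ⋯ ≥ μₙ ≥ λₙ₊₁`. -/
def interlacing (lam : Parts (n + 1)) : Finset (Parts n) :=
  (Fintype.piFinset fun i : Fin n => Finset.Icc (lam.1 i.succ) (lam.1 i.castSucc)).subtype Antitone

theorem mem_interlacing {lam : Parts (n + 1)} {mu : Parts n} :
    mu ∈ interlacing lam ↔ ∀ i, lam.1 i.succ ≤ mu.1 i ∧ mu.1 i ≤ lam.1 i.castSucc := by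
  simp only [interlacing, Finset.mem_subtype, Fintype.mem_piFinset, Finset.mem_Icc]

theorem antitone_of_interlaces {lam : Parts (n + 1)} {q : Fin n → ℕ}
    (h : ∀ i, lam.1 i.succ ≤ q i ∧ q i ≤ lam.1 i.castSucc) : Antitone q := by
  intro i j hij
  obtain rfl | hlt := hij.eq_or_lt
  · exact le_rfl
  · exact (h j).2.trans ((lam.2 (Fin.succ_le_castSucc_iff.mpr hlt)).trans (h i).1)

theorem sum_interlacing {M : Type*} [AddCommMonoid M] (lam : Parts (n + 1))
    (F : (Fin n → ℕ) → M) :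
    ∑ mu ∈ interlacing lam, F mu.1 =
      ∑ q ∈ Fintype.piFinset fun i : Fin n => Finset.Icc (lam.1 i.succ) (lam.1 i.castSucc), F q :=
  Finset.sum_subtype_of_mem F fun _ hq => antitone_of_interlaces fun i =>
    Finset.mem_Icc.mp (Fintype.mem_piFinset.mp hq i)

/-- The factor that the boxes with the largest entry contribute to the weight of a tableau of
shape `λ` whose other entries form a tableau of shape `μ`: `z` stands for `x_{n+1}`, and the
column `c` of row `i` has the parameter `y_{(n + 1) + c - i}`. -/
def lastEntryWeight (y : ℕ → R) (z : R) (lam : Parts (n + 1)) (mu : Parts n) : R :=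
  (∏ i : Fin n, ∏ c ∈ Finset.Ico (mu.1 i) (lam.1 i.castSucc), (z + y (n + c - i))) *
    factorialPow y z (lam.1 (Fin.last n))

theorem factorialPow_shiftedPart_castSucc (y : ℕ → R) (t z : R) (lam : Parts (n + 1))
    (i : Fin n) :
    factorialPow y t (shiftedPart lam i.castSucc) =
      (t - z) * ∑ k ∈ Finset.Icc (lam.1 i.succ) (lam.1 i.castSucc),
        (∏ c ∈ Finset.Ico k (lam.1 i.castSucc), (z + y (n + c - i))) *
          factorialPow y t (k + Fin.rev i) +
      (∏ c ∈ Finset.Ico (lam.1 i.succ) (lam.1 i.castSucc + 1), (z + y (Fin.rev i + c))) *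
        factorialPow y t (shiftedPart lam i.succ) := by
  have hcast : shiftedPart lam i.castSucc = lam.1 i.castSucc + 1 + Fin.rev i := by
    rw [shiftedPart, Fin.rev_castSucc, Fin.val_succ]
    ring
  have hsucc : shiftedPart lam i.succ = lam.1 i.succ + Fin.rev i := by
    rw [shiftedPart, Fin.rev_succ, Fin.val_castSucc]
  have hindex (c : ℕ) : (Fin.rev i : ℕ) + (c + 1) = n + c - i := by
    rw [Fin.val_rev]
    lia
  rw [hcast, hsucc, factorialPow_add,
    factorialPow_telescope _ t z (lam.2 (Fin.castSucc_lt_succ (i := i)).le)]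
  simp only [hindex, factorialPow_add y t _ (Fin.rev i), add_mul, mul_assoc, Finset.sum_mul]

theorem alternant_succ (y : ℕ → R) (x : Fin (n + 1) → R) (lam : Parts (n + 1)) :
    alternant y x lam = (∏ j : Fin n, (x j.castSucc - x (Fin.last n))) *
      ∑ mu ∈ interlacing lam, lastEntryWeight y (x (Fin.last n)) lam mu *
        alternant y (x ∘ Fin.castSucc) mu := by
  set z := x (Fin.last n)
  let w (i : Fin n) (k : ℕ) : R := ∏ c ∈ Finset.Ico k (lam.1 i.castSucc), (z + y (n + c - i))
  let S (i : Fin n) (t : R) : R :=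
    ∑ k ∈ Finset.Icc (lam.1 i.succ) (lam.1 i.castSucc), w i k * factorialPow y t (k + Fin.rev i)
  have hlast : alternant y x lam = factorialPow y z (lam.1 (Fin.last n)) *
      (Matrix.of fun i j : Fin n => (x j.castSucc - z) * S i (x j.castSucc)).det := by
    rw [alternant, det_eq_of_row_recurrence (B := Matrix.of fun i j => (x j - z) * S i (x j)) _
      (fun i j => factorialPow_shiftedPart_castSucc y (x j) z lam i) (fun i => by simp [z])]
    simp only [Matrix.of_apply, shiftedPart, Fin.rev_last, Fin.val_zero, add_zero]
    rfl
  have hminors : (Matrix.of fun i j : Fin n => S i (x j.castSucc)).det =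
      ∑ mu ∈ interlacing lam, (∏ i, w i (mu.1 i)) * alternant y (x ∘ Fin.castSucc) mu := by
    rw [det_of_sum_rows _ fun i k j => w i k * factorialPow y (x j.castSucc) (k + Fin.rev i),
      ← sum_interlacing]
    exact Finset.sum_congr rfl fun mu _ =>
      Matrix.det_mul_column (fun i => w i (mu.1 i)) (Matrix.of fun i j =>
        factorialPow y (x (Fin.castSucc j)) (shiftedPart mu i))
  have hcols := Matrix.det_mul_row (fun j : Fin n => x j.castSucc - z)
    (Matrix.of fun i j => S i (x j.castSucc))
  simp only [Matrix.of_apply] at hcols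
  rw [hlast, hcols, hminors, Finset.mul_sum, Finset.mul_sum, Finset.mul_sum]
  refine Finset.sum_congr rfl fun mu _ => ?_
  rw [lastEntryWeight]
  ring

end Alternants

section Tableaux

theorem val_lt_card_filter_iff {l : ℕ} {p : Fin l → Prop} [DecidablePred p]
    (hp : ∀ i j, i ≤ j → p j → p i) (i : Fin l) :
    (i : ℕ) < (Finset.univ.filter p).card ↔ p i := by
  constructor
  · contrapose!
    intro hi
    rw [← Fin.card_Iio]
    refine Finset.card_le_card fun j hj => Finset.mem_Iio.mpr (lt_of_not_ge fun hij => ?_)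
    exact hi (hp i j hij (Finset.mem_filter_univ j |>.mp hj))
  · intro hi
    rw [← Nat.succ_le_iff, Nat.succ_eq_add_one, ← Fin.card_Iic]
    exact Finset.card_le_card fun j hj =>
      (Finset.mem_filter_univ j).mpr (hp j i (Finset.mem_Iic.mp hj) hi)

theorem prod_univ_dite_lt {M : Type*} [CommMonoid M] {q l : ℕ} (h : q ≤ l) (f : Fin q → M)
    (g : ℕ → M) :
    ∏ c : Fin l, (if hc : (c : ℕ) < q then f ⟨c, hc⟩ else g c) =
      (∏ c, f c) * ∏ c ∈ Finset.Ico q l, g c := by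
  obtain ⟨k, rfl⟩ := Nat.exists_eq_add_of_le h
  simp [Fin.prod_univ_add, Finset.prod_Ico_eq_prod_range, Fin.prod_univ_eq_prod_range
    (fun i => g (q + i))]

variable {n : ℕ}

theorem mem_tableaux {lam : Parts n} {T : Box lam → Fin n} : T ∈ tableaux lam ↔ IsTableau T := by
  classical exact Finset.mem_filter_univ T

theorem IsTableau.row_le {lam : Parts n} {T : Box lam → Fin n} (hT : IsTableau T) (b : Box lam) :
    b.1 ≤ T b := by
  obtain ⟨⟨r, hr⟩, c⟩ := b
  induction r with
  | zero => exact Nat.zero_le _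
  | succ r ih =>
    have hle : lam.1 ⟨r + 1, hr⟩ ≤ lam.1 ⟨r, Nat.lt_of_succ_lt hr⟩ := lam.2 (Nat.le_succ r)
    exact Nat.succ_le_of_lt <| (ih _ (Fin.castLE hle c)).trans_lt <|
      hT.2 ⟨_, Fin.castLE hle c⟩ ⟨_, c⟩ rfl (Nat.lt_succ_self r)

/-- The row lengths of the shape formed by the entries different from the largest one. -/
def innerShape {lam : Parts (n + 1)} (T : Box lam → Fin (n + 1)) (r : Fin n) : ℕ :=
  (Finset.univ.filter fun c : Fin (lam.1 r.castSucc) => T ⟨r.castSucc, c⟩ < Fin.last n).card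

theorem IsTableau.lt_innerShape_iff {lam : Parts (n + 1)} {T : Box lam → Fin (n + 1)}
    (hT : IsTableau T) (r : Fin n) (c : Fin (lam.1 r.castSucc)) :
    (c : ℕ) < innerShape T r ↔ T ⟨r.castSucc, c⟩ < Fin.last n :=
  val_lt_card_filter_iff (p := fun c => T ⟨r.castSucc, c⟩ < Fin.last n)
    (fun d e hde => (hT.1 ⟨_, d⟩ ⟨_, e⟩ rfl hde).trans_lt) c

theorem IsTableau.innerShape_interlaces {lam : Parts (n + 1)} {T : Box lam → Fin (n + 1)}
    (hT : IsTableau T) (r : Fin n) :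
    lam.1 r.succ ≤ innerShape T r ∧ innerShape T r ≤ lam.1 r.castSucc := by
  refine ⟨not_lt.mp fun hlt => ?_, (Finset.card_le_univ _).trans_eq (Fintype.card_fin _)⟩
  have hcol := hlt.trans_le (lam.2 (Fin.castSucc_lt_succ (i := r)).le)
  refine lt_irrefl _ ((hT.lt_innerShape_iff r ⟨_, hcol⟩).mpr ?_)
  exact (hT.2 ⟨_, ⟨_, hcol⟩⟩ ⟨_, ⟨_, hlt⟩⟩ rfl Fin.castSucc_lt_succ).trans_le (Fin.le_last _)

/-- The filling of `lam` that agrees with `T` on `mu` and has the largest entry elsewhere. -/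
def extendTableau (lam : Parts (n + 1)) {mu : Parts n} (T : Box mu → Fin n) :
    Box lam → Fin (n + 1) := fun b =>
  if hr : (b.1 : ℕ) < n then
    if hc : (b.2 : ℕ) < mu.1 ⟨b.1, hr⟩ then (T ⟨⟨b.1, hr⟩, ⟨b.2, hc⟩⟩).castSucc else Fin.last n
  else Fin.last n

theorem extendTableau_castSucc {lam : Parts (n + 1)} {mu : Parts n} (T : Box mu → Fin n)
    (r : Fin n) (c : Fin (lam.1 r.castSucc)) :
    extendTableau lam T ⟨r.castSucc, c⟩ =
      if hc : (c : ℕ) < mu.1 r then (T ⟨r, ⟨c, hc⟩⟩).castSucc else Fin.last n :=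
  dif_pos r.isLt

theorem extendTableau_last {lam : Parts (n + 1)} {mu : Parts n} (T : Box mu → Fin n)
    (c : Fin (lam.1 (Fin.last n))) :
    extendTableau lam T ⟨Fin.last n, c⟩ = Fin.last n :=
  dif_neg (lt_irrefl n)

theorem extendTableau_lt_last_iff {lam : Parts (n + 1)} {mu : Parts n} (T : Box mu → Fin n)
    (r : Fin n) (c : Fin (lam.1 r.castSucc)) :
    extendTableau lam T ⟨r.castSucc, c⟩ < Fin.last n ↔ (c : ℕ) < mu.1 r := by
  rw [extendTableau_castSucc]
  split_ifs with hc <;> simp [hc, Fin.castSucc_lt_last]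

theorem innerShape_extendTableau {lam : Parts (n + 1)} {mu : Parts n} (hmu : mu ∈ interlacing lam)
    (T : Box mu → Fin n) : innerShape (extendTableau lam T) = mu.1 := by
  funext r
  simp only [innerShape, extendTableau_lt_last_iff, Fin.card_filter_val_lt]
  exact min_eq_right (mem_interlacing.mp hmu r).2

theorem isTableau_extendTableau {lam : Parts (n + 1)} {mu : Parts n} {T : Box mu → Fin n}
    (hmu : mu ∈ interlacing lam) (hT : IsTableau T) : IsTableau (extendTableau lam T) := by
  constructor
  · rintro ⟨r, c⟩ ⟨r', c'⟩ (rfl : r = r') (hc : (c : ℕ) ≤ c')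
    cases r using Fin.lastCases with
    | last => exact (extendTableau_last T c).trans (extendTableau_last T c').symm |>.le
    | cast r =>
      rw [extendTableau_castSucc, extendTableau_castSucc]
      split_ifs with hcr hcr'
      · exact Fin.castSucc_le_castSucc_iff.mpr (hT.1 _ _ rfl hc)
      · exact Fin.le_last _
      · exact absurd (hc.trans_lt ‹_›) hcr
      · exact le_rfl
  · rintro ⟨r, c⟩ ⟨r', c'⟩ (hc : (c : ℕ) = c') (hr : r < r')
    cases r using Fin.lastCases with
    | last => exact absurd (Fin.le_last r') hr.not_ge
    | cast r =>
      have hcr : (c : ℕ) < mu.1 r := by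
        rw [hc]
        exact c'.isLt.trans_le <| (lam.2 (Fin.castSucc_lt_iff_succ_le.mp hr)).trans
          (mem_interlacing.mp hmu r).1
      cases r' using Fin.lastCases with
      | last => rwa [extendTableau_last, extendTableau_lt_last_iff]
      | cast r' =>
        rw [extendTableau_castSucc, extendTableau_castSucc, dif_pos hcr]
        split_ifs with hcr'
        · exact Fin.castSucc_lt_castSucc_iff.mpr (hT.2 _ _ hc (Fin.castSucc_lt_castSucc_iff.mp hr))
        · exact Fin.castSucc_lt_last _

theorem extendTableau_injective {lam : Parts (n + 1)} {mu : Parts n} (hmu : mu ∈ interlacing lam) :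
    Function.Injective (extendTableau lam : (Box mu → Fin n) → Box lam → Fin (n + 1)) := by
  intro T T' h
  funext ⟨r, c⟩
  have hbox := congrFun h ⟨r.castSucc, Fin.castLE (mem_interlacing.mp hmu r).2 c⟩
  simpa [extendTableau_castSucc] using hbox

theorem IsTableau.exists_extendTableau_eq {lam : Parts (n + 1)} {T : Box lam → Fin (n + 1)}
    (hT : IsTableau T) :
    ∃ mu ∈ interlacing lam, ∃ T' : Box mu → Fin n,
      IsTableau T' ∧ extendTableau lam T' = T := by
  have hinter := hT.innerShape_interlaces
  let mu : Parts n := ⟨innerShape T, antitone_of_interlaces hinter⟩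
  have hlt (b : Box mu) : T ⟨b.1.castSucc, Fin.castLE (hinter b.1).2 b.2⟩ < Fin.last n :=
    (hT.lt_innerShape_iff b.1 _).mp b.2.isLt
  refine ⟨mu, mem_interlacing.mpr hinter, fun b => Fin.castPred _ (hlt b).ne,
    ⟨fun a b hrow hcol => ?_, fun a b hcol hrow => ?_⟩, ?_⟩
  · exact Fin.castPred_le_castPred_iff.mpr (hT.1 _ _ (congrArg Fin.castSucc hrow) hcol)
  · exact Fin.castPred_lt_castPred_iff.mpr (hT.2 _ _ hcol (Fin.castSucc_lt_castSucc_iff.mpr hrow))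
  · funext ⟨r, c⟩
    cases r using Fin.lastCases with
    | last => exact (extendTableau_last _ c).trans (Fin.last_le_iff.mp (hT.row_le ⟨_, c⟩)).symm
    | cast r =>
      rw [extendTableau_castSucc]
      split_ifs with hc
      · exact Fin.castSucc_castPred _ _
      · exact (Fin.last_le_iff.mp (not_lt.mp ((hT.lt_innerShape_iff r c).not.mp hc))).symm

variable {R : Type*} [CommRing R]

/-- The weight `∏_a (x_a + y_{a + c(a) - r(a)})` of a filling. -/
def tableauWeight (y : ℕ → R) (x : Fin n → R) {lam : Parts n} (T : Box lam → Fin n) : R :=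
  ∏ b : Box lam, (x (T b) + y ((T b : ℕ) + (b.2 : ℕ) - (b.1 : ℕ)))

theorem tableauWeight_extendTableau (y : ℕ → R) (x : Fin (n + 1) → R) {lam : Parts (n + 1)}
    {mu : Parts n} (hmu : mu ∈ interlacing lam) (T : Box mu → Fin n) :
    tableauWeight y x (extendTableau lam T) =
      lastEntryWeight y (x (Fin.last n)) lam mu * tableauWeight y (x ∘ Fin.castSucc) T := by
  let w (r c : ℕ) (a : Fin (n + 1)) : R := x a + y ((a : ℕ) + c - r)
  have hrow (r : Fin n) :
      ∏ c : Fin (lam.1 r.castSucc), w r c (extendTableau lam T ⟨r.castSucc, c⟩) =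
        (∏ c : Fin (mu.1 r), w r c (T ⟨r, c⟩).castSucc) *
          ∏ c ∈ Finset.Ico (mu.1 r) (lam.1 r.castSucc), w r c (Fin.last n) := by
    rw [← prod_univ_dite_lt (mem_interlacing.mp hmu r).2]
    refine Finset.prod_congr rfl fun c _ => ?_
    rw [extendTableau_castSucc, apply_dite (w r c)]
  have hlast : ∏ c : Fin (lam.1 (Fin.last n)), w n c (extendTableau lam T ⟨Fin.last n, c⟩) =
      factorialPow y (x (Fin.last n)) (lam.1 (Fin.last n)) := by
    simp only [extendTableau_last, w, Fin.val_last, Nat.add_sub_cancel_left]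
    exact Fin.prod_univ_eq_prod_range (fun c => x (Fin.last n) + y c) _
  calc tableauWeight y x (extendTableau lam T)
      = (∏ r : Fin n, ∏ c : Fin (lam.1 r.castSucc),
          w r c (extendTableau lam T ⟨r.castSucc, c⟩)) *
        ∏ c : Fin (lam.1 (Fin.last n)), w n c (extendTableau lam T ⟨Fin.last n, c⟩) := by
        rw [tableauWeight, Fintype.prod_sigma, Fin.prod_univ_castSucc]
        rfl
    _ = (∏ r : Fin n, ∏ c : Fin (mu.1 r), w r c (T ⟨r, c⟩).castSucc) *
        lastEntryWeight y (x (Fin.last n)) lam mu := by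
        simp only [hrow, hlast, Finset.prod_mul_distrib, mul_assoc]
        rfl
    _ = _ := by
        rw [mul_comm, tableauWeight, Fintype.prod_sigma]
        rfl

/-- The value of the factorial Schur polynomial in a commutative ring. -/
noncomputable def tableauSum (y : ℕ → R) (x : Fin n → R) (lam : Parts n) : R :=
  ∑ T ∈ tableaux lam, tableauWeight y x T

theorem tableauSum_succ (y : ℕ → R) (x : Fin (n + 1) → R) (lam : Parts (n + 1)) :
    tableauSum y x lam = ∑ mu ∈ interlacing lam,
      lastEntryWeight y (x (Fin.last n)) lam mu * tableauSum y (x ∘ Fin.castSucc) mu := by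
  simp only [tableauSum, Finset.mul_sum]
  rw [Finset.sum_sigma']
  symm
  refine Finset.sum_bij (fun T _ => extendTableau lam T.2) ?_ ?_ ?_ ?_
  · rintro ⟨mu, T⟩ hT
    obtain ⟨hmu, hT⟩ := Finset.mem_sigma.mp hT
    exact mem_tableaux.mpr (isTableau_extendTableau hmu (mem_tableaux.mp hT))
  · rintro ⟨mu, T⟩ hT ⟨mu', T'⟩ hT' (h : extendTableau lam T = extendTableau lam T')
    have hmu := (Finset.mem_sigma.mp hT).1
    obtain rfl : mu = mu' := Subtype.ext <| by
      rw [← innerShape_extendTableau hmu T, h,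
        innerShape_extendTableau (Finset.mem_sigma.mp hT').1]
    rw [extendTableau_injective hmu h]
  · intro T hT
    obtain ⟨mu, hmu, T', hT', rfl⟩ := (mem_tableaux.mp hT).exists_extendTableau_eq
    exact ⟨⟨mu, T'⟩, Finset.mem_sigma.mpr ⟨hmu, mem_tableaux.mpr hT'⟩, rfl⟩
  · rintro ⟨mu, T⟩ hT
    exact (tableauWeight_extendTableau y x (Finset.mem_sigma.mp hT).1 T).symm

theorem tableauSum_zero (y : ℕ → R) (x : Fin 0 → R) (lam : Parts 0) : tableauSum y x lam = 1 := by
  have htableaux : tableaux lam = {fun b => b.1.elim0} :=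
    Finset.eq_singleton_iff_unique_mem.mpr
      ⟨mem_tableaux.mpr ⟨fun a => a.1.elim0, fun a => a.1.elim0⟩,
        fun _ _ => funext fun b => b.1.elim0⟩
  rw [tableauSum, htableaux, Finset.sum_singleton, tableauWeight, Fintype.prod_sigma,
    Fin.prod_univ_zero]

theorem tableauSum_mul_vandermondeProd (y : ℕ → R) (x : Fin n → R) (lam : Parts n) :
    tableauSum y x lam * vandermondeProd x = alternant y x lam := by
  induction n with
  | zero => rw [tableauSum_zero, vandermondeProd, alternant, Fin.prod_univ_zero,
      Matrix.det_fin_zero, one_mul]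
  | succ n ih =>
    rw [alternant_succ, vandermondeProd_succ, tableauSum_succ, Finset.sum_mul, Finset.mul_sum]
    refine Finset.sum_congr rfl fun mu _ => ?_
    rw [← ih]
    ring

end Tableaux

section Polynomials

variable {n : ℕ} {R : Type*} [CommRing R]

theorem X_sub_X_mem_nonZeroDivisors {σ : Type*} [LinearOrder σ] [WellFoundedGT σ] {i j : σ}
    (hij : i < j) : (X i - X j : MvPolynomial σ R) ∈ nonZeroDivisors (MvPolynomial σ R) := by
  nontriviality R
  have hdegree : MonomialOrder.lex.toSyn (MonomialOrder.lex.degree (X j : MvPolynomial σ R)) <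
      MonomialOrder.lex.toSyn (MonomialOrder.lex.degree (X i : MvPolynomial σ R)) := by
    rw [MonomialOrder.degree_X, MonomialOrder.degree_X]
    exact Finsupp.Lex.single_lt_iff.mpr hij
  refine MonomialOrder.lex.mem_nonZeroDivisors_of_leadingCoeff_mem_nonZeroDivisors ?_
  rw [MonomialOrder.leadingCoeff_sub_of_lt hdegree, MonomialOrder.leadingCoeff_X]
  exact one_mem _

theorem vandermondeProd_X_mem_nonZeroDivisors :
    vandermondeProd (X : Fin n → MvPolynomial (Fin n) R) ∈
      nonZeroDivisors (MvPolynomial (Fin n) R) :=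
  prod_mem fun _ _ => prod_mem fun _ hi => X_sub_X_mem_nonZeroDivisors (Finset.mem_Iio.mp hi)

theorem alternant_algebraMap_eq_linearCombination {A : Type*} [CommRing A] [Algebra R A]
    (y z : ℕ → R) (x : Fin n → A) (lam : Parts n) :
    alternant (algebraMap R A ∘ y) x lam = Finsupp.linearCombination R
      (alternant (algebraMap R A ∘ z) x) (transitionMinor y z lam) := by
  rw [alternant_eq_linearCombination _ (algebraMap R A ∘ z), linearCombination_transitionMinor,
    linearCombination_transitionMinor]
  simp only [← map_transitionMinor, smul_eq_mul, Algebra.smul_def]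

/-- The factorial Schur polynomial with parameters `y` in an arbitrary coefficient ring; the Schur
polynomial is the case `y = 0`. -/
noncomputable def tableauPoly (y : ℕ → R) : Parts n → MvPolynomial (Fin n) R :=
  tableauSum (C ∘ y) X

theorem tableauPoly_mul_vandermondeProd (y : ℕ → R) (lam : Parts n) :
    tableauPoly y lam * vandermondeProd X = alternant (C ∘ y) X lam :=
  tableauSum_mul_vandermondeProd _ _ _

theorem tableauPoly_eq_linearCombination (y z : ℕ → R) (lam : Parts n) :
    tableauPoly y lam =
      Finsupp.linearCombination R (tableauPoly z) (transitionMinor y z lam) := by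
  refine (mul_cancel_right_mem_nonZeroDivisors vandermondeProd_X_mem_nonZeroDivisors).mp ?_
  rw [linearCombination_transitionMinor, Finset.sum_mul]
  simp only [smul_mul_assoc, tableauPoly_mul_vandermondeProd]
  rw [← linearCombination_transitionMinor]
  exact alternant_algebraMap_eq_linearCombination y z X lam

theorem coeff_alternant_zero_X (lam mu : Parts n) :
    coeff (Finsupp.equivFunOnFinite.symm (shiftedPart mu))
      (alternant 0 (X : Fin n → MvPolynomial (Fin n) R) lam) = Finsupp.single lam 1 mu := by
  have hmonomial (σ : Equiv.Perm (Fin n)) :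
      ∏ j, (X j : MvPolynomial (Fin n) R) ^ shiftedPart lam (σ j) =
        monomial (Finsupp.equivFunOnFinite.symm fun j => shiftedPart lam (σ j)) 1 := by
    rw [monomial_eq, Finsupp.prod_fintype _ _ fun _ => pow_zero _, C_1, one_mul]
    rfl
  rw [← transitionMinor_self 0, transitionMinor_apply, transitionMatrix_self, alternant,
    Matrix.det_apply, Matrix.det_apply, coeff_sum]
  refine Finset.sum_congr rfl fun σ _ => ?_
  simp only [Matrix.of_apply, factorialPow_zero_left, hmonomial, Units.smul_def, coeff_smul,
    coeff_monomial, Equiv.apply_eq_iff_eq, funext_iff, Matrix.submatrix_apply, Matrix.one_apply,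
    Finset.prod_ite_zero, Finset.mem_univ, true_imp_iff, Finset.prod_const_one]

theorem linearIndependent_alternant_zero_X :
    LinearIndependent R (alternant (n := n) 0 (X : Fin n → MvPolynomial (Fin n) R)) := by
  classical
  let coeffs : MvPolynomial (Fin n) R →ₗ[R] Parts n → R := LinearMap.pi fun mu =>
    lcoeff R (Finsupp.equivFunOnFinite.symm (shiftedPart mu))
  have hsingle : coeffs ∘ alternant 0 X = fun lam => Pi.single lam 1 := by
    ext lam mu
    exact (coeff_alternant_zero_X lam mu).trans (congrFun (Finsupp.single_eq_pi_single lam 1) mu)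
  refine .of_comp coeffs ?_
  rw [hsingle]
  exact Pi.linearIndependent_single_one (Parts n) R

theorem linearIndependent_transitionMinor (y z : ℕ → R) :
    LinearIndependent R (transitionMinor (n := n) y z) := by
  refine .of_comp (Finsupp.linearCombination R (transitionMinor z y)) ?_
  convert Finsupp.linearIndependent_single_one R (Parts n) using 1
  ext1 lam
  exact (linearCombination_transitionMinor_comp y z y lam).trans (transitionMinor_self y lam)

theorem linearIndependent_tableauPoly (y : ℕ → R) :
    LinearIndependent R (tableauPoly (n := n) y) := by
  have hzero : LinearIndependent R (tableauPoly (n := n) (0 : ℕ → R)) := by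
    have hnum : LinearMap.mulRight R (vandermondeProd X) ∘ tableauPoly (n := n) (0 : ℕ → R) =
        alternant 0 X := by
      ext1 lam
      refine (tableauPoly_mul_vandermondeProd 0 lam).trans (congrArg (alternant · X lam) ?_)
      exact funext fun _ => map_zero C
    refine .of_comp (LinearMap.mulRight R (vandermondeProd X)) ?_
    rw [hnum]
    exact linearIndependent_alternant_zero_X
  have hcomp : tableauPoly y =
      Finsupp.linearCombination R (tableauPoly (n := n) 0) ∘ transitionMinor y 0 :=
    funext (tableauPoly_eq_linearCombination y 0)
  rw [hcomp]
  exact (linearIndependent_transitionMinor y 0).map' _ (LinearMap.ker_eq_bot.mpr hzero)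

theorem schurPoly_eq_tableauPoly : schurPoly (n := n) = tableauPoly 0 := by
  funext lam
  simp [schurPoly, tableauPoly, tableauSum, tableauWeight]

theorem factorialSchurPoly_eq_tableauPoly : factorialSchurPoly (n := n) = tableauPoly X := rfl

theorem expansionCoeffs_eq {ι M : Type*} [AddCommGroup M] [Module R M] {b : ι → M}
    (hb : LinearIndependent R b) {f : M} {c : ι →₀ R}
    (h : f = Finsupp.linearCombination R b c) : expansionCoeffs b f = c :=
  hb <| (Classical.epsilon_spec (p := fun c : ι →₀ R => f = Finsupp.linearCombination R b c)
    ⟨c, h⟩).symm.trans h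

theorem cCoeff_eq (lam : Parts n) : cCoeff lam = transitionMinor X 0 lam := by
  rw [cCoeff, schurPoly_eq_tableauPoly, factorialSchurPoly_eq_tableauPoly]
  exact expansionCoeffs_eq (linearIndependent_tableauPoly 0)
    (tableauPoly_eq_linearCombination X 0 lam)

theorem dCoeff_eq (lam : Parts n) : dCoeff lam = transitionMinor 0 X lam := by
  rw [dCoeff, schurPoly_eq_tableauPoly, factorialSchurPoly_eq_tableauPoly]
  exact expansionCoeffs_eq (linearIndependent_tableauPoly X)
    (tableauPoly_eq_linearCombination 0 X lam)

end Polynomials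

section SumPermutationSign

variable {n m : ℕ}

theorem prod_Iio_natAdd {M : Type*} [CommMonoid M] (f : Fin (n + m) → M) (j : Fin m) :
    ∏ i ∈ Finset.Iio (Fin.natAdd n j), f i =
      (∏ i : Fin n, f (Fin.castAdd m i)) * ∏ i ∈ Finset.Iio j, f (Fin.natAdd n i) := by
  have lt_natAdd (i : Fin n) : Fin.castAdd m i < Fin.natAdd n j :=
    Nat.lt_add_right _ i.isLt
  simp only [← Finset.filter_gt_eq_Iio, Finset.prod_filter, Fin.prod_univ_add, lt_natAdd,
    Fin.natAdd_lt_natAdd_iff, if_true]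

theorem prod_prod_Iio_ite_lt_of_strictAnti {α : Type*} [Preorder α] [DecidableLT α]
    {f : Fin n → α} (hf : StrictAnti f) :
    ∏ j, ∏ i ∈ Finset.Iio j, (if f i < f j then 1 else -1 : ℤˣ) =
      ∏ j : Fin n, (-1) ^ (j : ℕ) := by
  refine Finset.prod_congr rfl fun j _ => ?_
  rw [Finset.prod_congr rfl fun i hi => if_neg (hf (Finset.mem_Iio.mp hi)).not_gt,
    Finset.prod_const, Fin.card_Iio]

theorem sign_finSumFinEquiv_symm_trans_of_strictAnti (e : Fin n ⊕ Fin m ≃ Fin (n + m))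
    (hl : StrictAnti (e ∘ Sum.inl)) (hr : StrictAnti (e ∘ Sum.inr)) :
    Equiv.Perm.sign (finSumFinEquiv.symm.trans e) =
      (∏ i : Fin n, (-1) ^ (i : ℕ)) * ((∏ j : Fin m, (-1) ^ (j : ℕ)) *
        ∏ j : Fin m, ∏ i : Fin n, if e (Sum.inl i) < e (Sum.inr j) then 1 else -1) := by
  rw [Equiv.Perm.sign_eq_prod_prod_Iio, Fin.prod_univ_add]
  simp only [Fin.prod_Iio_castAdd, prod_Iio_natAdd, Equiv.trans_apply,
    finSumFinEquiv_symm_apply_castAdd, finSumFinEquiv_symm_apply_natAdd,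
    Finset.prod_mul_distrib]
  rw [mul_comm (∏ j : Fin m, ∏ i : Fin n, _), ← prod_prod_Iio_ite_lt_of_strictAnti hl,
    ← prod_prod_Iio_ite_lt_of_strictAnti hr]
  rfl

end SumPermutationSign

section Complement

variable {n m : ℕ}

theorem lt_conj_iff (lam : Parts n) (t : ℕ) (i : Fin n) : (i : ℕ) < conj lam t ↔ t < lam.1 i :=
  val_lt_card_filter_iff (fun _ _ hij hj => hj.trans_le (lam.2 hij)) i

theorem conj_le (lam : Parts n) (t : ℕ) : conj lam t ≤ n :=
  (Finset.card_le_univ _).trans_eq (Fintype.card_fin n)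

theorem shiftedPart_complPart (lam : Parts n) (j : Fin m) :
    shiftedPart (complPart m lam) j = n - conj lam (Fin.rev j) + Fin.rev j := rfl

theorem shiftedPart_lt {lam : Parts n} (h : ∀ i, lam.1 i ≤ m) (i : Fin n) :
    shiftedPart lam i < n + m := by
  have := h i
  have := (Fin.rev i).isLt
  rw [shiftedPart]
  lia

theorem shiftedPart_complPart_lt (lam : Parts n) (j : Fin m) :
    shiftedPart (complPart m lam) j < n + m := by
  have := (Fin.rev j).isLt
  rw [shiftedPart_complPart]
  lia

theorem shiftedPart_lt_shiftedPart_complPart_iff (lam : Parts n) (i : Fin n) (j : Fin m) :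
    shiftedPart lam i < shiftedPart (complPart m lam) j ↔ lam.1 i ≤ Fin.rev j := by
  have := lt_conj_iff lam (Fin.rev j) i
  have := i.isLt
  rw [shiftedPart_complPart, shiftedPart, Fin.val_rev i]
  lia

theorem shiftedPart_ne_shiftedPart_complPart (lam : Parts n) (i : Fin n) (j : Fin m) :
    shiftedPart lam i ≠ shiftedPart (complPart m lam) j := by
  have := lt_conj_iff lam (Fin.rev j) i
  have := i.isLt
  rw [shiftedPart_complPart, shiftedPart, Fin.val_rev i]
  lia

/-- For `λ` inside the `n × m` rectangle, the shifted parts of `λ` and of its complement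
together enumerate `{0, …, n + m - 1}`. -/
noncomputable def complEquiv (lam : Parts n) (h : ∀ i, lam.1 i ≤ m) :
    Fin n ⊕ Fin m ≃ Fin (n + m) :=
  Equiv.ofBijective
    (Sum.elim (fun i => ⟨shiftedPart lam i, shiftedPart_lt h i⟩)
      fun j => ⟨shiftedPart (complPart m lam) j, shiftedPart_complPart_lt lam j⟩) <|
    (Fintype.bijective_iff_injective_and_card _).mpr
      ⟨Function.Injective.sumElim
        (fun _ _ hij => (strictAnti_shiftedPart _).injective (Fin.mk.inj hij))
        (fun _ _ hij => (strictAnti_shiftedPart _).injective (Fin.mk.inj hij))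
        fun i j hij => shiftedPart_ne_shiftedPart_complPart lam i j (Fin.mk.inj hij),
      by simp⟩

theorem prod_ite_shiftedPart_lt (lam : Parts n) (j : Fin m) :
    ∏ i, (if shiftedPart lam i < shiftedPart (complPart m lam) j then 1 else -1 : ℤˣ) =
      (-1) ^ (n + (Fin.rev j : ℕ)) * (-1) ^ shiftedPart (complPart m lam) j := by
  have prod_eq : ∏ i, (if shiftedPart lam i < shiftedPart (complPart m lam) j
      then 1 else -1 : ℤˣ) = (-1) ^ conj lam (Fin.rev j) := by
    simp only [shiftedPart_lt_shiftedPart_complPart_iff, ← not_lt, ite_not]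
    rw [← Finset.prod_filter, Finset.prod_const, conj]
  have := conj_le lam (Fin.rev j)
  rw [prod_eq, ← pow_add, shiftedPart_complPart,
    show n + (Fin.rev j : ℕ) + (n - conj lam (Fin.rev j) + Fin.rev j) =
      conj lam (Fin.rev j) + 2 * (n - conj lam (Fin.rev j) + Fin.rev j) by lia,
    pow_add _ _ (2 * _), pow_mul, neg_one_sq, one_pow, mul_one]

theorem sign_complEquiv {lam : Parts n} (h : ∀ i, lam.1 i ≤ m) :
    Equiv.Perm.sign (finSumFinEquiv.symm.trans (complEquiv lam h)) =
      (∏ i : Fin n, (-1) ^ (i : ℕ)) * ((∏ j : Fin m, (-1) ^ (j : ℕ)) *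
        ((∏ j : Fin m, (-1) ^ (n + (Fin.rev j : ℕ))) *
          (-1) ^ ∑ j, shiftedPart (complPart m lam) j)) := by
  rw [sign_finSumFinEquiv_symm_trans_of_strictAnti (complEquiv lam h)
      (strictAnti_shiftedPart lam) (strictAnti_shiftedPart (complPart m lam)),
    ← Finset.prod_pow_eq_pow_sum, ← Finset.prod_mul_distrib (f := fun j : Fin m => _ ^ (n + _))]
  simp only [← prod_ite_shiftedPart_lt]
  rfl

theorem sign_complEquiv_symm_trans {lam mu : Parts n} (hlam : ∀ i, lam.1 i ≤ m)
    (hmu : ∀ i, mu.1 i ≤ m) :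
    Equiv.Perm.sign ((complEquiv mu hmu).symm.trans (complEquiv lam hlam)) =
      (-1) ^ (∑ j, shiftedPart (complPart m mu) j + ∑ j, shiftedPart (complPart m lam) j) := by
  have factor : (complEquiv mu hmu).symm.trans (complEquiv lam hlam) =
      (finSumFinEquiv.symm.trans (complEquiv mu hmu)).symm.trans
        (finSumFinEquiv.symm.trans (complEquiv lam hlam)) := by
    ext; simp
  rw [factor, Equiv.Perm.sign_trans, Equiv.Perm.sign_symm, sign_complEquiv, sign_complEquiv]
  simp only [mul_mul_mul_comm _ _ (∏ _, _), Int.units_mul_self, one_mul]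
  rw [← pow_add, add_comm]

end Complement

section Duality

variable {n m : ℕ} {R : Type*} [CommRing R]

theorem transitionMinor_neg (y z : ℕ → R) (lam mu : Parts n) :
    transitionMinor (-y) (-z) lam mu =
      (-1) ^ (∑ i, shiftedPart lam i + ∑ i, shiftedPart mu i) * transitionMinor y z lam mu := by
  rw [transitionMinor_apply, transitionMinor_apply, pow_add, ← Finset.prod_pow_eq_pow_sum,
    ← Finset.prod_pow_eq_pow_sum, mul_assoc, ← Matrix.det_mul_row, ← Matrix.det_mul_column]
  congr 1
  ext i j
  simp only [Matrix.submatrix_apply, Matrix.of_apply, transitionMatrix_neg, pow_add, mul_assoc]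

/-- The leading `N × N` block of the transition matrix. -/
def truncTransitionMatrix (y z : ℕ → R) (N : ℕ) : Matrix (Fin N) (Fin N) R :=
  (transitionMatrix y z).submatrix Fin.val Fin.val

theorem det_truncTransitionMatrix (y z : ℕ → R) (N : ℕ) :
    (truncTransitionMatrix y z N).det = 1 := by
  rw [Matrix.det_of_isLowerTriangular
    (M := truncTransitionMatrix y z N) fun _ _ hij => transitionMatrix_of_lt y z hij]
  exact Finset.prod_eq_one fun i _ => transitionMatrix_apply_self y z i

theorem truncTransitionMatrix_mul_swap (y z : ℕ → R) (N : ℕ) :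
    truncTransitionMatrix y z N * truncTransitionMatrix z y N = 1 := by
  ext p r
  rw [Matrix.mul_apply]
  calc ∑ q : Fin N, transitionMatrix y z p q * transitionMatrix z y q r
      = ∑ q ∈ Finset.range N, transitionMatrix y z p q * transitionMatrix z y q r :=
        (Finset.sum_range fun q => transitionMatrix y z p q * transitionMatrix z y q r).symm
    _ = (1 : Matrix ℕ ℕ R) p r := by
        rw [sum_transitionMatrix_mul_transitionMatrix y z y p.isLt, transitionMatrix_self]
    _ = (1 : Matrix (Fin N) (Fin N) R) p r := by
        simp only [Matrix.one_apply, Fin.val_inj]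

theorem transitionMinor_eq_transitionMinor_complPart (y z : ℕ → R) {lam mu : Parts n}
    (hlam : ∀ i, lam.1 i ≤ m) (hmu : ∀ i, mu.1 i ≤ m) :
    transitionMinor y z lam mu =
      transitionMinor (-z) (-y) (complPart m mu) (complPart m lam) := by
  have jacobi := jacobi_complementary_minor (truncTransitionMatrix_mul_swap z y (n + m))
    (complEquiv mu hmu) (complEquiv lam hlam)
  simp only [det_truncTransitionMatrix, one_mul, sign_complEquiv_symm_trans,
    Units.val_pow_eq_pow_val, Units.val_neg, Units.val_one, Int.cast_pow, Int.cast_neg,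
    Int.cast_one] at jacobi
  have signed_duality : (-1) ^ (∑ j, shiftedPart (complPart m mu) j +
      ∑ j, shiftedPart (complPart m lam) j) * transitionMinor y z lam mu =
        transitionMinor z y (complPart m mu) (complPart m lam) := jacobi
  rw [transitionMinor_neg, ← signed_duality, ← mul_assoc, ← mul_pow, neg_one_mul, neg_neg,
    one_pow, one_mul]

theorem negY_transitionMinor_X_zero (lam mu : Parts n) :
    negY (transitionMinor X 0 lam mu) = transitionMinor (-X) (-0) lam mu := by
  have negY_comp_X : negY ∘ X = (-X : ℕ → ZY) := funext fun k => aeval_X _ k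
  have negY_comp_zero : negY ∘ (0 : ℕ → ZY) = -0 := by
    rw [Pi.comp_zero, map_zero, neg_zero, Function.const_zero]
  rw [← negY_comp_X, ← negY_comp_zero]
  exact map_transitionMinor (negY : ZY →+* ZY) X 0 lam mu

end Duality

theorem propositionp (n : ℕ) :
    -- the coefficients `c` and `d` are well defined by the change of basis formulas
    (LinearIndependent ZY (schurPoly (n := n)) ∧
      LinearIndependent ZY (factorialSchurPoly (n := n)) ∧
      (∀ lam : Parts n, factorialSchurPoly lam =
        (cCoeff lam).sum fun mu a => a • schurPoly mu) ∧
      (∀ lam : Parts n, schurPoly lam =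
        (dCoeff lam).sum fun mu a => a • factorialSchurPoly mu)) ∧
    -- (i)
    (∀ lam mu : Parts n, cCoeff lam mu =
      (Matrix.of fun i j : Fin n =>
        eInt ((lam.1 i : ℤ) - mu.1 j - i + j) (lam.1 i + n - (i + 1))
          (fun k => (MvPolynomial.X k : ZY))).det) ∧
    -- (ii)
    (∀ lam mu : Parts n, dCoeff lam mu =
      (Matrix.of fun i j : Fin n =>
        hInt ((lam.1 i : ℤ) - mu.1 j - i + j) (mu.1 j + n + 1 - (j + 1))
          (fun k => (-MvPolynomial.X k : ZY))).det) ∧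
    -- (iii)
    (∀ (lam mu : Parts n) (m : ℕ), (∀ i, lam.1 i ≤ m) → (∀ i, mu.1 i ≤ m) →
      dCoeff lam mu = negY (cCoeff (complPart m mu) (complPart m lam))) := by
  simp only [schurPoly_eq_tableauPoly, factorialSchurPoly_eq_tableauPoly, cCoeff_eq, dCoeff_eq,
    ← Finsupp.linearCombination_apply, negY_transitionMinor_X_zero]
  exact ⟨⟨linearIndependent_tableauPoly 0, linearIndependent_tableauPoly X,
    tableauPoly_eq_linearCombination X 0, tableauPoly_eq_linearCombination 0 X⟩,
    transitionMinor_zero_right X, transitionMinor_zero_left X,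
    fun _ _ _ => transitionMinor_eq_transitionMinor_complPart 0 X⟩
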